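/- For a finite simple graph $G$ on $n$ vertices let $Q(G)=D(G)+A(G)$ be its signless Laplacian matrix, where $D(G)$ is the diagonal matrix of vertex degrees and $A(G)$ is the adjacency matrix, and define the signless Laplacian coefficients $\varphi_0(G),\dots,\varphi_n(G)$ by $$\det(xI-Q(G))=\sum_{i=0}^{n}(-1)^i\varphi_i(G)\,x^{n-i}.$$ A unicyclic graph is a connected graph with as many edges as vertices; its girth is the length of its unique cycle. Theorem 5.1. Let $n\ge 3$, and let $S_3'$ be the graph on $n$ vertices obtained from a triangle by attaching $n-3$ pendent edges at one of its vertices. Then $S_3'$ has the minimum signless Laplacian coefficients among all $n$-vertex unicyclic graphs with odd girth. That is, $S_3'$ is itself a unicyclic graph with odd girth, and for every $n$-vertex unicyclic graph $G$ with odd girth, $$\varphi_i(S_3')\le\varphi_i(G)\qquad\text{for all } i=0,1,\dots,n.$$ -/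

import Mathlib

/-- The signless Laplacian matrix `Q(G) = D(G) + A(G)` of a finite simple graph. -/
noncomputable def SimpleGraph.signlessLaplacian {V : Type*} [Fintype V] [DecidableEq V]
    (G : SimpleGraph V) [DecidableRel G.Adj] : Matrix V V ℝ :=
  G.degMatrix ℝ + G.adjMatrix ℝ

/-- The signless Laplacian coefficient `φ_i(G)`: with `n = |V(G)|`, these are the numbers for which
`det (x I - Q(G)) = ∑_{i=0}^n (-1)^i φ_i x^(n-i)`. Meaningful for `i ≤ n` only. -/
noncomputable def SimpleGraph.signlessCoeff {V : Type*} [Fintype V] [DecidableEq V]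
    (G : SimpleGraph V) [DecidableRel G.Adj] (i : ℕ) : ℝ :=
  (-1) ^ i * G.signlessLaplacian.charpoly.coeff (Fintype.card V - i)

/-- The expansion that `signlessCoeff` is meant to satisfy. -/
theorem SimpleGraph.charpoly_signlessLaplacian {V : Type*} [Fintype V] [DecidableEq V]
    (G : SimpleGraph V) [DecidableRel G.Adj] :
    G.signlessLaplacian.charpoly = ∑ i ∈ Finset.range (Fintype.card V + 1),
      Polynomial.C ((-1) ^ i * G.signlessCoeff i) * Polynomial.X ^ (Fintype.card V - i) := by
  have h : ∀ i, (-1 : ℝ) ^ i * G.signlessCoeff i =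
      G.signlessLaplacian.charpoly.coeff (Fintype.card V - i) := by
    intro i
    rw [SimpleGraph.signlessCoeff, ← mul_assoc, ← mul_pow]
    simp
  simp only [h]
  have hd : G.signlessLaplacian.charpoly.natDegree = Fintype.card V :=
    Matrix.charpoly_natDegree_eq_dim _
  conv_lhs => rw [Polynomial.as_sum_range_C_mul_X_pow G.signlessLaplacian.charpoly, hd]
  rw [← Finset.sum_range_reflect]
  exact Finset.sum_congr rfl fun i _ => by rw [Nat.add_sub_cancel]

/-- A unicyclic graph: connected, with as many edges as vertices. -/
def SimpleGraph.IsUnicyclic {V : Type*} (G : SimpleGraph V) : Prop :=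
  G.Connected ∧ G.edgeSet.ncard = Nat.card V

/-- The graph `S₃'` on `n ≥ 3` vertices: the triangle on `0, 1, 2`, and `n - 3` pendent edges
joining the vertices `3, …, n - 1` to the vertex `0`. -/
def triangleWithPendants (n : ℕ) : SimpleGraph (Fin n) where
  Adj a b := a ≠ b ∧ (a.val = 0 ∨ b.val = 0 ∨ (a.val ≤ 2 ∧ b.val ≤ 2))
  symm := ⟨fun a b h => by grind⟩
  loopless := ⟨fun a h => h.1 rfl⟩

instance (n : ℕ) : DecidableRel (triangleWithPendants n).Adj := fun a b =>
  inferInstanceAs (Decidable (a ≠ b ∧ (a.val = 0 ∨ b.val = 0 ∨ (a.val ≤ 2 ∧ b.val ≤ 2))))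

/-! Write P_G = det(1 + X Q(G)). Its i-th coefficient is the sum of the i×i principal minors of
Q(G), which is φ_i(G), so the claim is a coefficientwise inequality between polynomials. Let v be a
leaf at w and H = G − v. The edge vw contributes a rank-one term to Q(G), and expanding gives P_G =
(1 + X) P_H + X R_{H,w}, where R_{H,w} is the same determinant after zeroing row and column w of
Q(H) (`detOneAdd_of_pendant`). To close an induction on leaves, two bounds are carried together for
m vertices: P_G ≥ P_S with S the triangle with pendents, and R_{G,u} ≥ (1 + X)^(m-2) (1 + 3X) for
every vertex u (`detOneAdd_lower_bounds`). For S both are equalities, the second at its centre,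
because each pendent edge is attached there. A unicyclic graph without leaves is a cycle. Its
determinants are explicit and are compared with the bounds through linear recurrences. Odd girth
enters only as non-bipartiteness, which survives the deletion of a leaf. -/

section

open Polynomial

/-! ### Determinants det(1 + XM), grounding and rank-one updates. -/

namespace Matrix

section CommRing

variable {V W R : Type*} [DecidableEq V] [DecidableEq W] [CommRing R]

/-- The matrix `M` with row and column `u` replaced by zero. -/
def ground (M : Matrix V V R) (u : V) : Matrix V V R :=
  of fun i j => if i = u ∨ j = u then 0 else M i j

theorem ground_apply (M : Matrix V V R) (u i j : V) :
    M.ground u i j = if i = u ∨ j = u then 0 else M i j := rfl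

theorem ground_of_zero {M : Matrix V V R} {v : V} (hr : ∀ j, M v j = 0) (hc : ∀ i, M i v = 0) :
    M.ground v = M := by
  ext i j
  rw [ground_apply]
  split_ifs with h
  · rcases h with rfl | rfl
    · exact (hr _).symm
    · exact (hc _).symm
  · rfl

theorem ground_submatrix (M : Matrix V V R) {f : W → V} (hf : Function.Injective f) (u : W) :
    (M.submatrix f f).ground u = (M.ground (f u)).submatrix f f := by
  ext i j
  simp [ground_apply, hf.eq_iff]

variable [Fintype V] [Fintype W]

/-- The polynomial `det (1 + X M)`. -/
noncomputable def detOneAdd (M : Matrix V V R) : R[X] := det (1 + (X : R[X]) • M.map C)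

theorem detOneAdd_submatrix_equiv (M : Matrix V V R) (e : W ≃ V) :
    (M.submatrix e e).detOneAdd = M.detOneAdd := by
  have : 1 + (X : R[X]) • (M.submatrix e e).map C =
      (1 + (X : R[X]) • M.map C).submatrix e e := by
    ext i j : 1
    simp [Matrix.one_apply]
  rw [detOneAdd, this, det_submatrix_equiv_self, detOneAdd]

/-- A determinant with a row that is a unit vector is the complementary principal minor. -/
theorem det_eq_of_row_eq_single {A : Matrix V V R} {v : V} (h : A v = Pi.single v 1) {f : W → V}
    (hf : Function.Injective f) (hv : ∀ x, x ≠ v ↔ x ∈ Set.range f) :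
    A.det = (A.submatrix f f).det := by
  rw [twoBlockTriangular_det A (fun x => x ≠ v)]
  · have h1 : (toSquareBlockProp A fun x => ¬ x ≠ v).det = 1 := by
      have : Unique {x // ¬ x ≠ v} := ⟨⟨⟨v, by simp⟩⟩, fun x => Subtype.ext (not_not.1 x.2)⟩
      rw [det_unique]
      have hd : (default : {x // ¬ x ≠ v}).1 = v := not_not.1 (default : {x // ¬ x ≠ v}).2
      simp [toSquareBlockProp, hd, h]
    let e : W ≃ {x // x ≠ v} := Equiv.ofBijective (fun w => ⟨f w, (hv _).2 ⟨w, rfl⟩⟩)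
      ⟨fun a b hab => hf (congrArg Subtype.val hab), fun x => by
        obtain ⟨w, hw⟩ := (hv _).1 x.2
        exact ⟨w, Subtype.ext hw⟩⟩
    rw [h1, mul_one, ← det_submatrix_equiv_self e]
    rfl
  · intro i hi j hj
    rw [not_not] at hi
    subst hi
    simp [h, hj]

theorem detOneAdd_eq_submatrix {M : Matrix V V R} {v : V} (h : ∀ j, M v j = 0) {f : W → V}
    (hf : Function.Injective f) (hv : ∀ x, x ≠ v ↔ x ∈ Set.range f) :
    M.detOneAdd = (M.submatrix f f).detOneAdd := by
  rw [detOneAdd, det_eq_of_row_eq_single (v := v) _ hf hv, detOneAdd]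
  · congr 1
    ext i j : 1
    simp [Matrix.one_apply, hf.eq_iff]
  · ext j : 1
    simp [h, Matrix.one_apply, Pi.single_apply, eq_comm]

/-- Both matrices have the unit vector as row w, so both determinants equal the minor away from w.
Grounding thus plays the role of deleting an index without changing the index type. -/
theorem det_updateRow_single_eq_detOneAdd_ground (M : Matrix V V R) (w : V) :
    ((1 + (X : R[X]) • M.map C).updateRow w (Pi.single w 1)).det = (M.ground w).detOneAdd := by
  rw [det_eq_of_row_eq_single (v := w) (f := ((↑) : {x // x ≠ w} → V)) (updateRow_self ..)
    Subtype.val_injective (by simp),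
    detOneAdd, det_eq_of_row_eq_single (v := w) (f := ((↑) : {x // x ≠ w} → V)) _
    Subtype.val_injective (by simp)]
  · congr 1
    ext i j : 1
    have hi := i.2
    have hj := j.2
    simp [Matrix.one_apply, ground_apply, updateRow_apply, hi, hj]
  · ext j : 1
    simp [ground_apply, Matrix.one_apply, Pi.single_apply, eq_comm]

theorem detOneAdd_add_single (M : Matrix V V R) (w : V) :
    (M + single w w 1).detOneAdd = M.detOneAdd + X * (M.ground w).detOneAdd := by
  set A : Matrix V V R[X] := 1 + (X : R[X]) • M.map C with hA
  have : 1 + (X : R[X]) • (M + single w w 1).map C =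
      A.updateRow w (A w + (X : R[X]) • Pi.single w 1) := by
    ext i j : 1
    by_cases hi : i = w
    · subst hi
      by_cases hj : j = i
      · subst hj; simp [hA, mul_add, add_assoc]
      · have hj' : i ≠ j := Ne.symm hj
        simp [hA, hj, hj']
    · have hi' : w ≠ i := Ne.symm hi
      simp [hA, hi, hi', updateRow_apply]
  rw [detOneAdd, this, det_updateRow_add, det_updateRow_smul, updateRow_eq_self,
    det_updateRow_single_eq_detOneAdd_ground, hA, ← detOneAdd]

/-- The effect on `det (1 + X M)` of attaching a pendent edge `vw` at `w`. -/
theorem detOneAdd_add_pendant {M : Matrix V V R} {v w : V} (hvw : v ≠ w) (hr : ∀ j, M v j = 0)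
    (hc : ∀ i, M i v = 0) :
    (M + vecMulVec (Pi.single w 1 + Pi.single v 1) (Pi.single w 1 + Pi.single v 1)).detOneAdd =
      (1 + X) * M.detOneAdd + X * (M.ground w).detOneAdd := by
  set A : Matrix V V R[X] := 1 + (X : R[X]) • M.map C with hA
  set z : V → R[X] := Pi.single w 1 + Pi.single v 1 with hz
  have hAv : A v = Pi.single v 1 := by
    ext j : 1
    simp [hA, hr, Matrix.one_apply, Pi.single_apply, eq_comm]
  have hzw : z w = 1 := by simp [hz, hvw.symm]
  have hzv : z v = 1 := by simp [hz, hvw]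
  have hC : ∀ i j, C (vecMulVec (Pi.single w 1 + Pi.single v 1 : V → R)
      (Pi.single w 1 + Pi.single v 1) i j) = z i * z j := by
    intro i j
    simp only [hz, vecMulVec_apply, Pi.add_apply, Pi.single_apply]
    split_ifs <;> simp
  -- Only rows w and v change, each by X z, so multilinearity in these two rows suffices.
  have key : 1 + (X : R[X]) • (M + vecMulVec (Pi.single w 1 + Pi.single v 1)
      (Pi.single w 1 + Pi.single v 1)).map C =
      (A.updateRow w (A w + (X : R[X]) • z)).updateRow v (Pi.single v 1 + (X : R[X]) • z) := by
    ext i j : 1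
    rw [add_apply, smul_apply, map_apply, add_apply, map_add, hC, smul_add, ← add_assoc]
    change A i j + _ = _
    by_cases hi : i = v
    · rw [hi, updateRow_self, ← hAv, hzv]
      simp
    · rw [updateRow_ne hi]
      by_cases hiw : i = w
      · rw [hiw, updateRow_self, hzw]
        simp
      · rw [updateRow_ne hiw]
        simp [hz, hi, hiw]
  have hwv : w ≠ v := hvw.symm
  -- With row v equal to e_v, the e_v part of z in row w repeats row v and drops out.
  have h1 : ((A.updateRow w (A w + (X : R[X]) • z)).updateRow v (Pi.single v 1)).det =
      M.detOneAdd + X * (M.ground w).detOneAdd := by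
    rw [updateRow_comm _ hwv, ← hAv, updateRow_eq_self, det_updateRow_add, det_updateRow_smul,
      updateRow_eq_self, hz, det_updateRow_add, det_updateRow_single_eq_detOneAdd_ground]
    rw [det_zero_of_row_eq hwv (M := A.updateRow w (Pi.single v 1))]
    · simp [detOneAdd, hA]
    · rw [updateRow_self, updateRow_ne hvw, hAv]
  -- With row v equal to z, the term X z in row w drops out. Of z = e_w + e_v in row v, the e_w part
  -- leaves column v zero and the e_v part restores A.
  have h2 : ((A.updateRow w (A w + (X : R[X]) • z)).updateRow v z).det = M.detOneAdd := by
    rw [updateRow_comm _ hwv, det_updateRow_add, det_updateRow_smul]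
    rw [det_zero_of_row_eq hwv (M := (A.updateRow v z).updateRow w z)]
    · rw [mul_zero, add_zero, ← updateRow_comm _ hwv, updateRow_eq_self, hz, det_updateRow_add,
        ← hAv, updateRow_eq_self]
      rw [det_eq_zero_of_column_eq_zero v, zero_add, detOneAdd]
      intro i
      by_cases hi : i = v
      · subst hi; simp [hvw]
      · rw [updateRow_ne hi]; simp [hA, hi, hc]
    · rw [updateRow_self, updateRow_ne hvw, updateRow_self]
  rw [detOneAdd, key, det_updateRow_add, det_updateRow_smul, h1, h2]
  ring

/-- Up to sign, both coefficients are the sum of the principal minors of size i. -/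
theorem charpoly_coeff_eq_coeff_detOneAdd (M : Matrix V V R) {i : ℕ} (hi : i ≤ Fintype.card V) :
    (-1) ^ i * M.charpoly.coeff (Fintype.card V - i) = M.detOneAdd.coeff i := by
  rw [charpoly_coeff_eq_sum_minors M i hi, ← mul_assoc, ← mul_pow, detOneAdd,
    coeff_det_one_add_X_smul_eq_sum_minors]
  simp

end CommRing

section Real

variable {V : Type*} [Fintype V] [DecidableEq V]

theorem PosSemidef.coeff_detOneAdd_nonneg {M : Matrix V V ℝ} (h : M.PosSemidef) (i : ℕ) :
    0 ≤ M.detOneAdd.coeff i := by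
  rw [detOneAdd, coeff_det_one_add_X_smul_eq_sum_minors]
  exact Finset.sum_nonneg fun s _ => (h.submatrix _).det_nonneg

theorem PosSemidef.ground {M : Matrix V V ℝ} (h : M.PosSemidef) (u : V) :
    (M.ground u).PosSemidef := by
  have : M.ground u = (diagonal fun i => if i = u then (0 : ℝ) else 1)ᴴ * M *
      (diagonal fun i => if i = u then (0 : ℝ) else 1) := by
    ext i j
    rw [diagonal_conjTranspose, mul_diagonal, diagonal_mul, ground_apply]
    by_cases hi : i = u <;> by_cases hj : j = u <;> simp [hi, hj]
  rw [this]
  exact h.conjTranspose_mul_mul_same _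

end Real

end Matrix

/-! ### Coefficientwise inequalities for the comparison polynomials. -/

namespace Polynomial

/-- All coefficients of the real polynomial `p` are nonnegative. -/
def CoeffNonneg (p : ℝ[X]) : Prop := ∀ i, 0 ≤ p.coeff i

namespace CoeffNonneg

variable {p q : ℝ[X]}

theorem add (hp : p.CoeffNonneg) (hq : q.CoeffNonneg) : (p + q).CoeffNonneg := fun i => by
  rw [coeff_add]
  exact add_nonneg (hp i) (hq i)

theorem mul (hp : p.CoeffNonneg) (hq : q.CoeffNonneg) : (p * q).CoeffNonneg := fun i => by
  rw [coeff_mul]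
  exact Finset.sum_nonneg fun x _ => mul_nonneg (hp _) (hq _)

theorem var : (X : ℝ[X]).CoeffNonneg := fun i => by
  rw [coeff_X]
  split_ifs <;> simp

theorem natCast (n : ℕ) : (n : ℝ[X]).CoeffNonneg := fun i => by
  rw [coeff_natCast_ite]
  split_ifs <;> simp

theorem ofNat (n : ℕ) [n.AtLeastTwo] : (ofNat(n) : ℝ[X]).CoeffNonneg := natCast n

theorem zero : (0 : ℝ[X]).CoeffNonneg := by simpa using natCast 0

theorem one : (1 : ℝ[X]).CoeffNonneg := by simpa using natCast 1

theorem pow (hp : p.CoeffNonneg) (n : ℕ) : (p ^ n).CoeffNonneg := by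
  induction n with
  | zero => simpa using one
  | succ n ih => rw [pow_succ]; exact ih.mul hp

theorem one_add_X : (1 + X : ℝ[X]).CoeffNonneg := one.add var

end CoeffNonneg

open CoeffNonneg

/-- The solution of `D (n + 2) = (1 + 2 X) D (n + 1) - X ^ 2 D n` starting with `1`, `1 + 2 X`:
the determinant of the tridiagonal matrix with diagonal `1 + 2 X` and off-diagonal `X`. -/
noncomputable def pathPoly : ℕ → ℝ[X]
  | 0 => 1
  | 1 => 1 + 2 * X
  | n + 2 => (1 + 2 * X) * pathPoly (n + 1) - X ^ 2 * pathPoly n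

/-- The solution of `L (n + 2) = (1 + 2 X) L (n + 1) - X ^ 2 L n` starting with `2`, `1 + 2 X`. -/
noncomputable def cyclePoly : ℕ → ℝ[X]
  | 0 => 2
  | 1 => 1 + 2 * X
  | n + 2 => (1 + 2 * X) * cyclePoly (n + 1) - X ^ 2 * cyclePoly n

/-- `det (1 + X Q)` for the triangle with `k` pendent edges at one vertex. -/
noncomputable def trianglePendantPoly (k : ℕ) : ℝ[X] :=
  (1 + X) ^ k * (1 + ((k : ℝ[X]) + 6) * X + 3 * ((k : ℝ[X]) + 3) * X ^ 2 + 4 * X ^ 3)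

theorem trianglePendantPoly_succ (k : ℕ) :
    trianglePendantPoly (k + 1) =
      (1 + X) * trianglePendantPoly k + X * ((1 + X) ^ (k + 1) * (1 + 3 * X)) := by
  simp only [trianglePendantPoly]
  push_cast
  ring

/-- The recurrence has a negative term, so the differences E n = D (n + 1) - X D n are carried
along: they satisfy E (n + 1) = D (n + 1) + X E n. -/
theorem pathPoly_nonneg (n : ℕ) :
    (pathPoly n).CoeffNonneg ∧ (pathPoly (n + 1) - X * pathPoly n).CoeffNonneg := by
  induction n with
  | zero =>
    refine ⟨one, ?_⟩
    convert one_add_X using 1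
    simp only [pathPoly]
    ring
  | succ n ih =>
    have h : (pathPoly (n + 1)).CoeffNonneg := by
      convert ih.2.add (var.mul ih.1) using 1
      ring
    refine ⟨h, ?_⟩
    convert h.add (var.mul ih.2) using 1
    rw [pathPoly]
    ring

/-- D (n + 3) = (1 + X) D (n + 2) + X E (n + 1) with E ≥ 0, and equality holds at n = 0. -/
theorem pathPoly_sub_nonneg (n : ℕ) :
    (pathPoly (n + 2) - (1 + X) ^ (n + 1) * (1 + 3 * X)).CoeffNonneg := by
  induction n with
  | zero =>
    convert zero using 1
    simp only [pathPoly]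
    ring
  | succ n ih =>
    convert (one_add_X.mul ih).add (var.mul (pathPoly_nonneg (n + 1)).2) using 1
    rw [pathPoly]
    ring

theorem cyclePoly_nonneg (n : ℕ) :
    (cyclePoly n).CoeffNonneg ∧ (cyclePoly (n + 1) - X * cyclePoly n).CoeffNonneg := by
  induction n with
  | zero =>
    refine ⟨ofNat 2, ?_⟩
    convert one using 1
    simp only [cyclePoly]
    ring
  | succ n ih =>
    have h : (cyclePoly (n + 1)).CoeffNonneg := by
      convert ih.2.add (var.mul ih.1) using 1
      ring
    refine ⟨h, ?_⟩
    convert h.add (var.mul ih.2) using 1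
    rw [cyclePoly]
    ring

/-- This is the increment in the induction for `cyclePoly_sub_trianglePendantPoly_nonneg`. The term
2 X ^ (n + 2) compensates for 2 X ^ (n + 3) being multiplied by X rather than by 1 + X there. -/
theorem cyclePoly_sub_X_mul_sub_nonneg (n : ℕ) :
    (cyclePoly (n + 3) - X * cyclePoly (n + 2) - 2 * X ^ (n + 2) -
      (1 + X) ^ (n + 1) * (1 + 3 * X)).CoeffNonneg := by
  induction n with
  | zero =>
    convert var using 1
    simp only [cyclePoly]
    ring
  | succ n ih =>
    convert ((var.mul ih).add ih).add ((var.mul (cyclePoly_nonneg (n + 2)).1).add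
      ((ofNat 2).mul (var.pow (n + 2)))) using 1
    rw [cyclePoly]
    ring

theorem cyclePoly_sub_trianglePendantPoly_nonneg (n : ℕ) :
    (cyclePoly (n + 3) + 2 * X ^ (n + 3) - trianglePendantPoly n).CoeffNonneg := by
  induction n with
  | zero =>
    convert zero using 1
    simp only [cyclePoly, trianglePendantPoly]
    push_cast
    ring
  | succ n ih =>
    convert (one_add_X.mul ih).add (var.mul (cyclePoly_sub_X_mul_sub_nonneg n)) using 1
    rw [trianglePendantPoly_succ, cyclePoly]
    ring

/-- After the substitution, the characteristic equation of the recurrence has roots (1 + X)² and X².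
Two consecutive indices are carried because the recurrence has order two. -/
theorem cyclePoly_comp (n : ℕ) :
    (cyclePoly n).comp (X + X ^ 2) = (1 + X) ^ (2 * n) + X ^ (2 * n) ∧
      (cyclePoly (n + 1)).comp (X + X ^ 2) =
        (1 + X) ^ (2 * (n + 1)) + X ^ (2 * (n + 1)) := by
  induction n with
  | zero =>
    constructor
    · simp only [cyclePoly, ofNat_comp]
      ring
    · simp only [cyclePoly, add_comp, one_comp, mul_comp, ofNat_comp, X_comp]
      ring
  | succ n ih =>
    refine ⟨ih.2, ?_⟩
    simp only [cyclePoly, sub_comp, add_comp, one_comp, mul_comp, ofNat_comp, X_comp, pow_comp,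
      ih.1, ih.2]
    ring

/-- Used when the grounded vertex is the deleted leaf, to turn the bound on P_H into one of the
second kind. -/
theorem trianglePendantPoly_sub_nonneg (k : ℕ) :
    (trianglePendantPoly k - (1 + X) ^ (k + 1) * (1 + 3 * X)).CoeffNonneg := by
  have h : (((k : ℝ[X]) + 2) * X + (3 * (k : ℝ[X]) + 6) * X ^ 2 + 4 * X ^ 3).CoeffNonneg :=
    ((((natCast k).add (ofNat 2)).mul var).add
      ((((ofNat 3).mul (natCast k)).add (ofNat 6)).mul (var.pow 2))).add ((ofNat 4).mul (var.pow 3))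
  convert (one_add_X.pow k).mul h using 1
  rw [trianglePendantPoly]
  ring

theorem comp_X_add_X_sq_injective :
    Function.Injective fun p : ℝ[X] => p.comp (X + X ^ 2) := by
  intro p q h
  have h0 : (p - q).comp (X + X ^ 2) = 0 := by rw [sub_comp, sub_eq_zero]; exact h
  rw [comp_eq_zero_iff] at h0
  rcases h0 with h0 | ⟨-, h0⟩
  · exact sub_eq_zero.1 h0
  · have := congrArg (fun r => coeff r 1) h0
    simp [coeff_X] at this

end Polynomial

/-! ### Tridiagonal and cyclic bidiagonal determinants. -/

namespace Matrix

/-- The tridiagonal matrix with diagonal entries `a` and off-diagonal entries `b`. -/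
def tridiagonal {R : Type*} [Zero R] (n : ℕ) (a b : R) : Matrix (Fin n) (Fin n) R :=
  of fun i j => if i = j then a else if i.val + 1 = j.val ∨ j.val + 1 = i.val then b else 0

theorem det_tridiagonal_succ_succ {R : Type*} [CommRing R] (n : ℕ) (a b : R) :
    (tridiagonal (n + 2) a b).det =
      a * (tridiagonal (n + 1) a b).det - b ^ 2 * (tridiagonal n a b).det := by
  have h1 : (tridiagonal (n + 2) a b).submatrix Fin.succ (Fin.succAbove 0) =
      tridiagonal (n + 1) a b := by
    ext i j
    simp [tridiagonal, Fin.ext_iff]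
  have h2 : ((tridiagonal (n + 2) a b).submatrix Fin.succ (Fin.succAbove 1)).det =
      b * (tridiagonal n a b).det := by
    rw [det_succ_column_zero, Fin.sum_univ_succ, Finset.sum_eq_zero]
    · have : ((tridiagonal (n + 2) a b).submatrix Fin.succ (Fin.succAbove 1)).submatrix
          (Fin.succAbove 0) Fin.succ = tridiagonal n a b := by
        ext i j
        have : (1 : Fin (n + 2)).succAbove j.succ = j.succ.succ := by
          rw [← Fin.succ_zero_eq_one, Fin.succ_succAbove_succ, Fin.zero_succAbove]
        simp [tridiagonal, Fin.ext_iff, this]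
      rw [this]
      simp [tridiagonal, Fin.ext_iff]
    · intro i _
      have : (tridiagonal (n + 2) a b).submatrix Fin.succ (Fin.succAbove 1) i.succ 0 = 0 := by
        simp [tridiagonal, Fin.ext_iff]
      rw [this]
      ring
  rw [det_succ_row_zero, Fin.sum_univ_succ, Fin.sum_univ_succ, Finset.sum_eq_zero]
  · rw [h1, Fin.succ_zero_eq_one, h2]
    simp [tridiagonal, Fin.ext_iff]
    ring
  · intro i _
    have : tridiagonal (n + 2) a b 0 i.succ.succ = 0 := by
      simp [tridiagonal, Fin.ext_iff]
    rw [this]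
    ring

theorem det_tridiagonal_eq_pathPoly (n : ℕ) :
    (tridiagonal n (1 + 2 * X : ℝ[X]) X).det = pathPoly n := by
  induction n using Nat.twoStepInduction with
  | zero => simp [pathPoly]
  | one => simp [pathPoly, tridiagonal]
  | more n ih1 ih2 => rw [det_tridiagonal_succ_succ, ih1, ih2, pathPoly]

/-- The cyclic matrix with diagonal entries `a` and entries `b` just above the diagonal. -/
def cyclicBidiagonal {R : Type*} [Zero R] (n : ℕ) [NeZero n] (a b : R) :
    Matrix (Fin n) (Fin n) R :=
  of fun i j => if i = j then a else if j = i + 1 then b else 0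

/-- The first column has only its top and bottom entries, and the corresponding minors are
triangular. -/
theorem det_cyclicBidiagonal {R : Type*} [CommRing R] (n : ℕ) (a b : R) :
    (cyclicBidiagonal (n + 2) a b).det = a ^ (n + 2) - (-b) ^ (n + 2) := by
  have h1 : ((cyclicBidiagonal (n + 2) a b).submatrix (Fin.succAbove 0) Fin.succ).det =
      a ^ (n + 1) := by
    rw [det_of_isUpperTriangular]
    · simp [cyclicBidiagonal]
    · intro i j hij
      have hij' : j.val < i.val := hij
      have h3 : j.succ ≠ i.succ + 1 := by
        intro h
        have := congrArg Fin.val h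
        rw [Fin.val_add_one] at this
        split_ifs at this
        all_goals simp at this
        all_goals omega
      simp [cyclicBidiagonal, (Fin.lt_def.2 hij').ne', h3]
  have h2 : ((cyclicBidiagonal (n + 2) a b).submatrix (Fin.last (n + 1)).succAbove
      Fin.succ).det = b ^ (n + 1) := by
    rw [det_of_isLowerTriangular]
    · have : ∀ i : Fin (n + 1), i.castSucc ≠ i.succ := fun i => Fin.castSucc_lt_succ.ne
      simp [cyclicBidiagonal, this]
    · intro i j hij
      have hij' : i.val < j.val := hij
      have h3 : i.castSucc ≠ j.succ := by
        intro h
        have := congrArg Fin.val h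
        simp at this
        omega
      simp [cyclicBidiagonal, h3, (Fin.lt_def.2 hij').ne']
  rw [det_succ_column_zero, Fin.sum_univ_succ, Fin.sum_univ_castSucc, Finset.sum_eq_zero]
  · rw [h1, Fin.succ_last, h2]
    have : cyclicBidiagonal (n + 2) a b (Fin.last (n + 1)) 0 = b := by
      simp [cyclicBidiagonal, Fin.ext_iff]
    rw [this]
    simp [cyclicBidiagonal]
    ring
  · intro i _
    have : cyclicBidiagonal (n + 2) a b i.castSucc.succ 0 = 0 := by
      have h3 : (0 : Fin (n + 2)) ≠ i.castSucc.succ + 1 := by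
        intro h
        have := congrArg Fin.val h
        rw [Fin.val_add_one] at this
        split_ifs at this with h'
        · have := congrArg Fin.val h'
          simp at this
          omega
        · simp at this
      simp [cyclicBidiagonal, h3]
    rw [this]
    ring

end Matrix

/-! ### The signless Laplacian under removal of a pendent vertex. -/

namespace SimpleGraph

open Matrix

section Matrix

variable {V W : Type*} [Fintype V] [DecidableEq V] [Fintype W]
  (G : SimpleGraph V) [DecidableRel G.Adj] {H : SimpleGraph W} [DecidableRel H.Adj]

theorem signlessLaplacian_apply (i j : V) :
    G.signlessLaplacian i j = if i = j then (G.degree i : ℝ) else if G.Adj i j then 1 else 0 := by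
  by_cases h : i = j
  · subst h; simp [signlessLaplacian, degMatrix]
  · simp [signlessLaplacian, degMatrix, h]

/-- Q is the unsigned incidence matrix times its transpose. -/
theorem posSemidef_signlessLaplacian : G.signlessLaplacian.PosSemidef := by
  have : G.signlessLaplacian = G.incMatrix ℝ * (G.incMatrix ℝ)ᴴ := by
    ext i j
    rw [conjTranspose_eq_transpose_of_trivial, incMatrix_mul_transpose, signlessLaplacian_apply]
    rfl
  rw [this]
  exact posSemidef_self_mul_conjTranspose _

variable {G}

theorem degree_eq_of_pendant {v w : V} (hw : ∀ x, G.Adj v x ↔ x = w) (f : W ↪ V)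
    (hv : ∀ x, x ≠ v ↔ x ∈ Set.range f) (hf : ∀ a b, H.Adj a b ↔ G.Adj (f a) (f b)) (a : W) :
    (G.degree (f a) : ℝ) = H.degree a + if f a = w then 1 else 0 := by
  have hu : (Finset.univ : Finset V) = insert v (Finset.univ.map f) := by
    ext x
    have := hv x
    simp only [Finset.mem_univ, Finset.mem_insert, Finset.mem_map, true_and, true_iff]
    by_cases hx : x = v
    · exact Or.inl hx
    · exact Or.inr ((hv x).1 hx)
  have hn : v ∉ Finset.univ.map f := by
    simp only [Finset.mem_map, Finset.mem_univ, true_and]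
    exact fun h => (hv v).2 h rfl
  rw [degree_eq_sum_if_adj, degree_eq_sum_if_adj, hu, Finset.sum_insert hn, Finset.sum_map,
    add_comm]
  simp [hf, G.adj_comm _ v, hw]

variable [DecidableEq W]

theorem signlessLaplacian_submatrix_iso (e : H ≃g G) :
    G.signlessLaplacian.submatrix e.toEquiv e.toEquiv = H.signlessLaplacian := by
  ext i j
  have hd : G.degree (e i) = H.degree i := e.degree_eq i
  have ha : G.Adj (e i) (e j) ↔ H.Adj i j := e.map_adj_iff
  simp only [submatrix_apply, signlessLaplacian_apply]
  change (if e i = e j then (G.degree (e i) : ℝ) else if G.Adj (e i) (e j) then 1 else 0) = _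
  simp [hd, ha]

/-- Removing a pendent edge changes the signless Laplacian by a rank-one matrix. -/
theorem exists_signlessLaplacian_eq_add {v w : V} (hw : ∀ x, G.Adj v x ↔ x = w) (f : W ↪ V)
    (hv : ∀ x, x ≠ v ↔ x ∈ Set.range f) (hf : ∀ a b, H.Adj a b ↔ G.Adj (f a) (f b)) :
    ∃ M : Matrix V V ℝ, (∀ j, M v j = 0) ∧ (∀ i, M i v = 0) ∧
      M.submatrix f f = H.signlessLaplacian ∧ G.signlessLaplacian =
        M + vecMulVec (Pi.single w 1 + Pi.single v 1) (Pi.single w 1 + Pi.single v 1) := by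
  have hvw : v ≠ w := ((hw w).2 rfl).ne
  have hdeg : G.degree v = 1 := degree_eq_one_iff_existsUnique_adj.2 ⟨w, (hw w).2 rfl,
    fun y hy => (hw y).1 hy⟩
  have hrow : ∀ j, G.signlessLaplacian v j = (Pi.single w 1 + Pi.single v 1 : V → ℝ) j := by
    intro j
    rw [signlessLaplacian_apply, hdeg]
    by_cases h : v = j
    · subst h; simp [hvw]
    · by_cases h' : j = w
      · subst h'; simp [hw, h, hvw.symm]
      · simp [hw, h, h', Ne.symm h]
  have hsymm : ∀ i j, G.signlessLaplacian i j = G.signlessLaplacian j i := by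
    intro i j
    simp only [signlessLaplacian_apply, eq_comm (a := i) (b := j), G.adj_comm i j]
    split_ifs with h
    · rw [h]
    · rfl
    · rfl
  refine ⟨G.signlessLaplacian -
    vecMulVec (Pi.single w 1 + Pi.single v 1) (Pi.single w 1 + Pi.single v 1), ?_, ?_, ?_, by simp⟩
  · intro j
    rw [Matrix.sub_apply, hrow, vecMulVec_apply]
    simp [hvw]
  · intro i
    rw [Matrix.sub_apply, hsymm, hrow, vecMulVec_apply]
    simp [hvw]
  · ext a b
    have hfv : ∀ a, f a ≠ v := fun a => (hv _).2 ⟨a, rfl⟩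
    have hd := degree_eq_of_pendant hw f hv hf a
    rw [submatrix_apply, Matrix.sub_apply, signlessLaplacian_apply, signlessLaplacian_apply,
      vecMulVec_apply]
    by_cases hab : a = b
    · subst hab
      by_cases haw : f a = w
      · simp [hd, haw, hvw.symm]
      · simp [hd, haw, hfv]
    · have hab' : f a ≠ f b := fun h => hab (f.injective h)
      by_cases haw : f a = w
      · have hbw : f b ≠ w := fun h => hab' (haw.trans h.symm)
        simp [hab, hab', hf, hfv, hbw]
      · simp [hab, hab', hf, hfv, haw]

theorem detOneAdd_of_pendant {v : V} {w : W} (f : W ↪ V) (hw : ∀ x, G.Adj v x ↔ x = f w)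
    (hv : ∀ x, x ≠ v ↔ x ∈ Set.range f) (hf : ∀ a b, H.Adj a b ↔ G.Adj (f a) (f b)) :
    G.signlessLaplacian.detOneAdd = (1 + X) * H.signlessLaplacian.detOneAdd +
      X * (H.signlessLaplacian.ground w).detOneAdd := by
  obtain ⟨M, hr, hc, hM, hG⟩ := exists_signlessLaplacian_eq_add hw f hv hf
  have hvw : v ≠ f w := ((hw _).2 rfl).ne
  rw [hG, detOneAdd_add_pendant hvw hr hc, detOneAdd_eq_submatrix hr f.injective hv, hM,
    detOneAdd_eq_submatrix (M := M.ground (f w)) (v := v) _ f.injective hv,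
    ← ground_submatrix _ f.injective, hM]
  intro j
  simp [ground_apply, hr]

/-- Grounding u away from v and w leaves the rank-one term of the edge vw intact, so the pendent
edge formula applies to the grounded matrix. -/
theorem detOneAdd_ground_of_pendant_of_ne {v : V} {w u : W} (f : W ↪ V)
    (hw : ∀ x, G.Adj v x ↔ x = f w) (hv : ∀ x, x ≠ v ↔ x ∈ Set.range f)
    (hf : ∀ a b, H.Adj a b ↔ G.Adj (f a) (f b)) (hu : u ≠ w) :
    (G.signlessLaplacian.ground (f u)).detOneAdd =
      (1 + X) * (H.signlessLaplacian.ground u).detOneAdd +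
      X * ((H.signlessLaplacian.ground u).ground w).detOneAdd := by
  obtain ⟨M, hr, hc, hM, hG⟩ := exists_signlessLaplacian_eq_add hw f hv hf
  have hvw : v ≠ f w := ((hw _).2 rfl).ne
  have huv : f u ≠ v := (hv _).2 ⟨u, rfl⟩
  have huw : f u ≠ f w := fun h => hu (f.injective h)
  have h1 : G.signlessLaplacian.ground (f u) = M.ground (f u) +
      vecMulVec (Pi.single (f w) 1 + Pi.single v 1) (Pi.single (f w) 1 + Pi.single v 1) := by
    ext i j
    rw [hG, Matrix.add_apply, ground_apply, ground_apply, vecMulVec_apply]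
    split_ifs with h
    · rcases h with rfl | rfl <;> simp [huv, huw]
    · simp [vecMulVec_apply]
  have hr' : ∀ j, M.ground (f u) v j = 0 := by simp [ground_apply, hr]
  rw [h1, detOneAdd_add_pendant hvw hr' (by simp [ground_apply, hc]),
    detOneAdd_eq_submatrix hr' f.injective hv,
    detOneAdd_eq_submatrix (M := (M.ground (f u)).ground (f w)) (v := v)
      (by simp [ground_apply, hr]) f.injective hv,
    ← ground_submatrix _ f.injective, ← ground_submatrix _ f.injective,
    ← ground_submatrix _ f.injective, hM]

/-- Grounding w leaves of the edge vw only the diagonal entry 1 at v. -/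
theorem detOneAdd_ground_of_pendant_neighbor {v : V} {w : W} (f : W ↪ V)
    (hw : ∀ x, G.Adj v x ↔ x = f w) (hv : ∀ x, x ≠ v ↔ x ∈ Set.range f)
    (hf : ∀ a b, H.Adj a b ↔ G.Adj (f a) (f b)) :
    (G.signlessLaplacian.ground (f w)).detOneAdd =
      (1 + X) * (H.signlessLaplacian.ground w).detOneAdd := by
  obtain ⟨M, hr, hc, hM, hG⟩ := exists_signlessLaplacian_eq_add hw f hv hf
  have hvw : v ≠ f w := ((hw _).2 rfl).ne
  have h1 : G.signlessLaplacian.ground (f w) = M.ground (f w) + single v v 1 := by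
    ext i j
    rw [hG, Matrix.add_apply, ground_apply, ground_apply, single_apply]
    split_ifs with h h' h'
    · obtain ⟨rfl, rfl⟩ := h'
      simp [hvw] at h
    · simp
    · obtain ⟨rfl, rfl⟩ := h'
      simp [vecMulVec_apply, hvw]
    · have : v ≠ i ∨ v ≠ j := by tauto
      push Not at h
      rcases this with h' | h' <;> simp [vecMulVec_apply, h, h'.symm]
  have hr' : ∀ j, M.ground (f w) v j = 0 := by simp [ground_apply, hr]
  rw [h1, detOneAdd_add_single, ground_of_zero hr' (by simp [ground_apply, hc]),
    detOneAdd_eq_submatrix hr' f.injective hv, ← ground_submatrix _ f.injective, hM]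
  ring

/-- Grounding v leaves of the edge vw only an extra 1 on the diagonal at w. -/
theorem detOneAdd_ground_of_pendant_self {v : V} {w : W} (f : W ↪ V)
    (hw : ∀ x, G.Adj v x ↔ x = f w) (hv : ∀ x, x ≠ v ↔ x ∈ Set.range f)
    (hf : ∀ a b, H.Adj a b ↔ G.Adj (f a) (f b)) :
    (G.signlessLaplacian.ground v).detOneAdd =
      H.signlessLaplacian.detOneAdd + X * (H.signlessLaplacian.ground w).detOneAdd := by
  obtain ⟨M, hr, hc, hM, hG⟩ := exists_signlessLaplacian_eq_add hw f hv hf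
  have hvw : v ≠ f w := ((hw _).2 rfl).ne
  have h1 : G.signlessLaplacian.ground v = M + single (f w) (f w) 1 := by
    ext i j
    rw [hG, Matrix.add_apply, ground_apply, single_apply]
    split_ifs with h h' h'
    · obtain ⟨rfl, rfl⟩ := h'
      simp [hvw.symm] at h
    · rcases h with rfl | rfl <;> simp [hr, hc]
    · obtain ⟨rfl, rfl⟩ := h'
      simp [vecMulVec_apply, hvw.symm]
    · have : f w ≠ i ∨ f w ≠ j := by tauto
      push Not at h
      rcases this with h' | h' <;> simp [vecMulVec_apply, h, h'.symm]
  rw [h1, detOneAdd_add_single, detOneAdd_eq_submatrix hr f.injective hv, hM,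
    detOneAdd_eq_submatrix (M := M.ground (f w)) (v := v) _ f.injective hv,
    ← ground_submatrix _ f.injective, hM]
  intro j
  simp [ground_apply, hr]

theorem signlessCoeff_eq_coeff_detOneAdd {i : ℕ} (hi : i ≤ Fintype.card V) :
    G.signlessCoeff i = G.signlessLaplacian.detOneAdd.coeff i :=
  charpoly_coeff_eq_coeff_detOneAdd _ hi

end Matrix

/-! ### Cycle graphs. -/

section Cycle

theorem cycleGraph_adj_iff_add {n : ℕ} {i j : Fin (n + 2)} :
    (cycleGraph (n + 2)).Adj i j ↔ i = j + 1 ∨ j = i + 1 := by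
  rw [cycleGraph_adj, sub_eq_iff_eq_add, sub_eq_iff_eq_add, add_comm 1, add_comm 1]

/-- Substituting X + X² for X makes the matrix factor as N Nᵀ with N cyclic bidiagonal, since 1 +
2(X + X²) = (1 + X)² + X². Odd length gives det N = (1 + X)^(n+3) + X^(n+3), whose square has cross
term 2 (X + X²)^(n+3). -/
theorem detOneAdd_cycleGraph (n : ℕ) (hn : Odd (n + 3)) :
    (cycleGraph (n + 3)).signlessLaplacian.detOneAdd =
      cyclePoly (n + 3) + 2 * X ^ (n + 3) := by
  apply comp_X_add_X_sq_injective
  set N := cyclicBidiagonal (n + 3) (1 + X : ℝ[X]) X with hN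
  have hNij : ∀ i j, N i j = (if j = i then 1 + X else 0) + if j = i + 1 then X else 0 := by
    intro i j
    have : i ≠ i + 1 := fun h => by simpa using left_eq_add.1 h
    simp only [hN, cyclicBidiagonal, of_apply, eq_comm (a := i) (b := j)]
    split_ifs with h1 h2 <;> simp_all
  have key : (compRingHom (X + X ^ 2 : ℝ[X])).mapMatrix
      (1 + (X : ℝ[X]) • (cycleGraph (n + 3)).signlessLaplacian.map C) = N * Nᵀ := by
    ext i j : 1
    -- Length at least three keeps the two off-diagonal bands of N Nᵀ apart.
    have h2 : ∀ k : Fin (n + 3), k ≠ k + 1 + 1 := by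
      intro k h
      rw [add_assoc] at h
      have := congrArg Fin.val (left_eq_add.1 h)
      rw [Fin.val_add] at this
      simp [Nat.mod_eq_of_lt (show 2 < n + 3 by omega)] at this
    have h3 : j ≠ j + 1 := fun h => by simpa using left_eq_add.1 h
    simp only [mul_apply, transpose_apply, hNij, add_mul, ite_mul, zero_mul,
      Finset.sum_add_distrib, Finset.sum_ite_eq', Finset.mem_univ, if_true]
    simp only [RingHom.mapMatrix_apply, Matrix.map_apply, Matrix.add_apply, Matrix.smul_apply,
      signlessLaplacian_apply, cycleGraph_degree_three_le, cycleGraph_adj_iff_add, Matrix.one_apply,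
      coe_compRingHom_apply, smul_eq_mul]
    by_cases hij : i = j
    · subst hij
      simp [h3, show (C 2 : ℝ[X]) = 2 from rfl]
      ring
    · by_cases h : i = j + 1
      · simp [h, h2, h3.symm, (h2 j).symm]
        ring
      · by_cases h' : j = i + 1
        · simp [h', h2]
          ring
        · simp [hij, h, h', Ne.symm h']
  have hdet : N.det = (1 + X) ^ (n + 3) + X ^ (n + 3) := by
    rw [hN, det_cyclicBidiagonal, hn.neg_pow]
    ring
  have := congrArg Matrix.det key
  rw [← RingHom.map_det, det_mul, det_transpose, hdet] at this
  change (detOneAdd _).comp _ = _ at this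
  simp only [this, add_comp, (cyclePoly_comp (n + 3)).1, mul_comp, ofNat_comp, pow_comp, X_comp]
  have h2 : (X + X ^ 2 : ℝ[X]) ^ (n + 3) = X ^ (n + 3) * (1 + X) ^ (n + 3) := by
    rw [← mul_pow]
    ring
  rw [h2]
  ring

/-- By rotation the vertex may be taken to be 0. Deleting it leaves a path whose diagonal entries
are still 2, hence a tridiagonal matrix. -/
theorem detOneAdd_ground_cycleGraph (n : ℕ) (u : Fin (n + 3)) :
    ((cycleGraph (n + 3)).signlessLaplacian.ground u).detOneAdd = pathPoly (n + 2) := by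
  have h0 : ((cycleGraph (n + 3)).signlessLaplacian.ground u).detOneAdd =
      ((cycleGraph (n + 3)).signlessLaplacian.ground 0).detOneAdd := by
    let e : cycleGraph (n + 3) ≃g cycleGraph (n + 3) :=
      ⟨Equiv.addRight u, by simp [cycleGraph_adj]⟩
    rw [← detOneAdd_submatrix_equiv _ e.toEquiv]
    have h1 : u = e.toEquiv 0 := (zero_add u).symm
    conv_lhs => rw [h1]
    rw [← ground_submatrix _ e.toEquiv.injective, signlessLaplacian_submatrix_iso]
  rw [h0, detOneAdd_eq_submatrix (v := 0) (f := Fin.succ) (by simp [ground_apply])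
    (Fin.succ_injective _) (by simp), detOneAdd,
    ← det_tridiagonal_eq_pathPoly]
  congr 1
  ext i j : 1
  have hadj : (cycleGraph (n + 3)).Adj i.succ j.succ ↔
      i.val + 1 = j.val ∨ j.val + 1 = i.val := by
    rw [cycleGraph_adj_iff_add, Fin.ext_iff, Fin.ext_iff, Fin.val_add_one, Fin.val_add_one]
    simp only [Fin.val_succ, Fin.ext_iff, Fin.val_last]
    grind
  simp only [Matrix.add_apply, Matrix.smul_apply, Matrix.map_apply, submatrix_apply, ground_apply,
    signlessLaplacian_apply, cycleGraph_degree_three_le, hadj, Matrix.one_apply, tridiagonal,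
    of_apply, Fin.succ_inj, Fin.succ_ne_zero, or_self, if_false, smul_eq_mul]
  by_cases hij : i = j
  · subst hij
    simp [show (C 2 : ℝ[X]) = 2 from rfl]
    ring
  · simp only [hij, if_false]
    split_ifs <;> simp

/-- A connected graph with a cycle all of whose degrees are `2` is a cycle graph. -/
theorem exists_iso_cycleGraph {V : Type*} [Fintype V] {G : SimpleGraph V} [DecidableRel G.Adj]
    (hG : G.Connected) (hc : ¬ G.IsAcyclic) (hd : ∀ v, G.degree v = 2) :
    ∃ n, Nonempty (cycleGraph (n + 3) ≃g G) := by
  classical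
  rw [isAcyclic_iff_free_cycleGraph] at hc
  push Not at hc
  obtain ⟨m, hm, hfree⟩ := hc
  obtain ⟨n, rfl⟩ := Nat.exists_eq_add_of_le' hm
  obtain ⟨f⟩ := hfree
  -- Both neighbourhoods have two elements, so the copy of the cycle contains every neighbour of its
  -- vertices; by connectedness it is all of G.
  have hn : ∀ i, ((cycleGraph (n + 3)).neighborFinset i).image f = G.neighborFinset (f i) := by
    intro i
    apply Finset.eq_of_subset_of_card_le
    · intro x hx
      obtain ⟨j, hj, rfl⟩ := Finset.mem_image.1 hx
      rw [mem_neighborFinset] at hj ⊢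
      exact f.toHom.map_adj hj
    · rw [Finset.card_image_of_injective (f := f) _ f.injective, card_neighborFinset_eq_degree,
        card_neighborFinset_eq_degree, hd, cycleGraph_degree_three_le]
  have hadj : ∀ i x, G.Adj (f i) x → ∃ j, (cycleGraph (n + 3)).Adj i j ∧ f j = x := by
    intro i x hx
    rw [← mem_neighborFinset, ← hn, Finset.mem_image] at hx
    obtain ⟨j, hj, rfl⟩ := hx
    exact ⟨j, by simpa using hj, rfl⟩
  have hsurj : Function.Surjective f := by
    intro x
    obtain ⟨p⟩ := hG.preconnected (f 0) x
    have : ∀ {a b : V} (p : G.Walk a b), (∃ i, f i = a) → ∃ i, f i = b := by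
      intro a b p
      induction p with
      | nil => exact id
      | cons h p ih =>
        rintro ⟨i, rfl⟩
        obtain ⟨j, -, hj⟩ := hadj i _ h
        exact ih ⟨j, hj⟩
    exact this p ⟨0, rfl⟩
  refine ⟨n, ⟨⟨Equiv.ofBijective f ⟨f.injective, hsurj⟩, ?_⟩⟩⟩
  intro i j
  refine ⟨fun h => ?_, fun h => f.toHom.map_adj h⟩
  obtain ⟨k, hk, hkj⟩ := hadj i _ h
  rwa [← f.injective hkj]

end Cycle

end SimpleGraph

/-! ### The induction on leaves. -/

namespace SimpleGraph

open Matrix Polynomial.CoeffNonneg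

/-- A two-coloring of `G` minus a vertex `v` with only one neighbor extends to `G`. -/
theorem colorable_two_of_induce {V : Type*} {G : SimpleGraph V} {v w : V}
    (hw : ∀ x, G.Adj v x ↔ x = w) (h : (G.induce {v}ᶜ).Colorable 2) : G.Colorable 2 := by
  classical
  obtain ⟨c⟩ := h
  have hvw : w ≠ v := ((hw w).2 rfl).ne'
  refine ⟨Coloring.mk (fun x => if hx : x = v then c ⟨w, hvw⟩ + 1 else c ⟨x, hx⟩) ?_⟩
  have key : ∀ a : Fin 2, a + 1 ≠ a := by decide
  intro a b hab
  by_cases ha : a = v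
  · subst ha
    obtain rfl := (hw b).1 hab
    simp [hvw, key]
  · by_cases hb : b = v
    · subst hb
      obtain rfl := (hw a).1 hab.symm
      simp [ha, (key _).symm]
    · simp only [ha, hb, dif_neg, not_false_iff]
      exact c.valid (by simpa using hab)

/-- A shortest cycle is an odd closed walk, which needs three colours. -/
theorem not_colorable_two_of_odd_girth {V : Type*} {G : SimpleGraph V} (h : Odd G.girth) :
    ¬ G.Colorable 2 := by
  have hc : ¬ G.IsAcyclic := fun hc => by simp [girth_eq_zero.2 hc] at h
  obtain ⟨a, p, -, hp⟩ := exists_girth_eq_length.2 hc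
  intro h2
  have h3 := p.three_le_chromaticNumber_of_odd_loop (hp ▸ h)
  have := h3.trans h2.chromaticNumber_le
  norm_num at this

/-- The degrees are positive with average 2, so without leaves none can exceed 2. -/
theorem exists_degree_eq_one_or_forall_degree_eq_two {V : Type*} [Fintype V] {G : SimpleGraph V}
    [DecidableRel G.Adj] [Nontrivial V] (hG : G.Connected)
    (he : G.edgeFinset.card = Fintype.card V) :
    (∃ v, G.degree v = 1) ∨ ∀ v, G.degree v = 2 := by
  classical
  by_contra! h
  obtain ⟨h1, u, hu⟩ := h
  have hpos : ∀ v, 2 ≤ G.degree v := fun v => by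
    have := hG.preconnected.degree_pos_of_nontrivial v
    have := h1 v
    omega
  have hlt : ∑ v : V, 2 < ∑ v, G.degree v :=
    Finset.sum_lt_sum (fun v _ => hpos v) ⟨u, Finset.mem_univ u, lt_of_le_of_ne (hpos u) hu.symm⟩
  rw [sum_degrees_eq_twice_card_edges, he] at hlt
  simp [mul_comm] at hlt

/-- Removing a vertex of degree one keeps the graph connected and not bipartite. -/
theorem induce_compl_leaf {V : Type*} [Fintype V] [DecidableEq V] {G : SimpleGraph V}
    [DecidableRel G.Adj] (hG : G.Connected) (h2 : ¬ G.Colorable 2) {v : V}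
    (hv : G.degree v = 1) :
    ∃ w : ({v}ᶜ : Set V), (∀ x, G.Adj v x ↔ x = w) ∧
      Fintype.card ({v}ᶜ : Set V) + 1 = Fintype.card V ∧ (G.induce {v}ᶜ).Connected ∧
      ¬ (G.induce {v}ᶜ).Colorable 2 ∧
      (G.induce {v}ᶜ).edgeFinset.card = G.edgeFinset.card - 1 := by
  obtain ⟨w, hw, huniq⟩ := degree_eq_one_iff_existsUnique_adj.1 hv
  have hw' : ∀ x, G.Adj v x ↔ x = w := fun x => ⟨huniq x, fun h => h ▸ hw⟩
  refine ⟨⟨w, hw.ne'⟩, hw', ?_, hG.induce_compl_singleton_of_degree_eq_one hv,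
    fun h => h2 (colorable_two_of_induce hw' h), ?_⟩
  · have := Fintype.card_pos_iff.2 ⟨v⟩
    rw [Fintype.card_compl_set, Set.card_singleton]
    omega
  · rw [card_edgeFinset_induce_compl_singleton, card_edgeFinset_deleteIncidenceSet, hv]

theorem detOneAdd_lower_bounds_of_degree_eq_two {V : Type*} [Fintype V] [DecidableEq V]
    {G : SimpleGraph V} [DecidableRel G.Adj] {n : ℕ} (hV : Fintype.card V = n + 3)
    (hG : G.Connected) (h2 : ¬ G.Colorable 2) (hd : ∀ v, G.degree v = 2) :
    (G.signlessLaplacian.detOneAdd - trianglePendantPoly n).CoeffNonneg ∧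
    ∀ u, ((G.signlessLaplacian.ground u).detOneAdd -
      (1 + X) ^ (n + 1) * (1 + 3 * X)).CoeffNonneg := by
  obtain ⟨m, ⟨e⟩⟩ := exists_iso_cycleGraph hG (fun h => h2 h.colorable_two) hd
  obtain rfl : m = n := by
    have := Fintype.card_congr e.toEquiv
    rw [Fintype.card_fin] at this
    omega
  have hodd : Odd (m + 3) := by
    by_contra h
    rw [Nat.not_odd_iff_even] at h
    have hc := (cycleGraph.bicoloring_of_even _ h).colorable
    exact h2 (Colorable.of_hom e.symm.toHom (by simpa using hc))
  constructor
  · rw [← detOneAdd_submatrix_equiv _ e.toEquiv, signlessLaplacian_submatrix_iso,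
      detOneAdd_cycleGraph m hodd]
    exact cyclePoly_sub_trianglePendantPoly_nonneg m
  · intro u
    obtain ⟨i, rfl⟩ := e.toEquiv.surjective u
    rw [← detOneAdd_submatrix_equiv _ e.toEquiv, ← ground_submatrix _ e.toEquiv.injective,
      signlessLaplacian_submatrix_iso, detOneAdd_ground_cycleGraph]
    exact pathPoly_sub_nonneg m

/-- The two coefficientwise lower bounds, proved by removing pendent vertices one by one. -/
theorem detOneAdd_lower_bounds (n : ℕ) : ∀ {V : Type*} [Fintype V] [DecidableEq V]
    (G : SimpleGraph V) [DecidableRel G.Adj], Fintype.card V = n + 3 → G.Connected →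
    ¬ G.Colorable 2 → G.edgeFinset.card = n + 3 →
    (G.signlessLaplacian.detOneAdd - trianglePendantPoly n).CoeffNonneg ∧
    ∀ u, ((G.signlessLaplacian.ground u).detOneAdd -
      (1 + X) ^ (n + 1) * (1 + 3 * X)).CoeffNonneg := by
  induction n with
  | zero =>
    intro V _ _ G _ hV hG h2 he
    have : Nontrivial V := Fintype.one_lt_card_iff_nontrivial.1 (by omega)
    obtain ⟨v, hv1⟩ | hd := exists_degree_eq_one_or_forall_degree_eq_two hG (he.trans hV.symm)
    -- Deleting a leaf would leave two vertices, which are 2-colourable.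
    · obtain ⟨w, hw, hcard, -, hH2, -⟩ := induce_compl_leaf hG h2 hv1
      refine absurd ((colorable_of_fintype (G.induce {v}ᶜ)).mono ?_) hH2
      omega
    · exact detOneAdd_lower_bounds_of_degree_eq_two hV hG h2 hd
  | succ n ih =>
    intro V _ _ G _ hV hG h2 he
    have : Nontrivial V := Fintype.one_lt_card_iff_nontrivial.1 (by omega)
    obtain ⟨v, hv1⟩ | hd := exists_degree_eq_one_or_forall_degree_eq_two hG (he.trans hV.symm)
    · obtain ⟨w, hw, hcard, hH, hH2, hHe⟩ := induce_compl_leaf hG h2 hv1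
      obtain ⟨hP, hR⟩ := ih (G.induce {v}ᶜ) (by omega) hH hH2 (by omega)
      have hrange : ∀ x, x ≠ v ↔ x ∈ Set.range (Function.Embedding.subtype (· ∈ ({v}ᶜ : Set V))) :=
        by simp
      have hadj : ∀ a b, (G.induce {v}ᶜ).Adj a b ↔ G.Adj
          (Function.Embedding.subtype (· ∈ ({v}ᶜ : Set V)) a)
          (Function.Embedding.subtype (· ∈ ({v}ᶜ : Set V)) b) := by simp
      constructor
      · rw [detOneAdd_of_pendant _ hw hrange hadj]
        convert (one_add_X.mul hP).add (var.mul (hR w)) using 1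
        rw [trianglePendantPoly_succ]
        ring
      · intro u
        by_cases huv : u = v
        · rw [huv, detOneAdd_ground_of_pendant_self _ hw hrange hadj]
          -- With B = (1 + X)^(n+1) (1 + 3X), the target (1 + X) B splits as B + X B, bounded by P_H
          -- and X R_{H,w} respectively.
          convert (hP.add (trianglePendantPoly_sub_nonneg n)).add (var.mul (hR w)) using 1
          ring
        · obtain ⟨u, rfl⟩ := (hrange u).1 huv
          by_cases huw : u = w
          · rw [huw, detOneAdd_ground_of_pendant_neighbor _ hw hrange hadj]
            convert one_add_X.mul (hR w) using 1
            ring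
          · rw [detOneAdd_ground_of_pendant_of_ne _ hw hrange hadj huw]
            -- The doubly grounded matrix is positive semidefinite, so its term can be dropped.
            have hpos := (((posSemidef_signlessLaplacian (G.induce {v}ᶜ)).ground
              u).ground w).coeff_detOneAdd_nonneg
            convert (one_add_X.mul (hR u)).add (var.mul hpos) using 1
            ring
    · exact detOneAdd_lower_bounds_of_degree_eq_two hV hG h2 hd

/-! ### The extremal graph. -/

theorem connected_triangleWithPendants (n : ℕ) : (triangleWithPendants (n + 3)).Connected := by
  have h : ∀ a, (triangleWithPendants (n + 3)).Reachable 0 a := fun a => by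
    by_cases ha : a = 0
    · rw [ha]
    · exact Adj.reachable ⟨Ne.symm ha, Or.inl rfl⟩
  exact ⟨fun a b => (h a).symm.trans (h b)⟩

theorem girth_triangleWithPendants (n : ℕ) : (triangleWithPendants (n + 3)).girth = 3 := by
  obtain ⟨a, ha⟩ : ∃ a : Fin (n + 3), a.val = 0 := ⟨⟨0, by omega⟩, rfl⟩
  obtain ⟨b, hb⟩ : ∃ b : Fin (n + 3), b.val = 1 := ⟨⟨1, by omega⟩, rfl⟩
  obtain ⟨c, hc⟩ : ∃ c : Fin (n + 3), c.val = 2 := ⟨⟨2, by omega⟩, rfl⟩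
  have hab : a ≠ b := fun h => by simp [h, hb] at ha
  have hbc : b ≠ c := fun h => by simp [h, hc] at hb
  have hca : c ≠ a := fun h => by simp [h, ha] at hc
  have h1 : (triangleWithPendants (n + 3)).Adj a b := ⟨hab, Or.inl ha⟩
  have h2 : (triangleWithPendants (n + 3)).Adj b c := ⟨hbc, by omega⟩
  have h3 : (triangleWithPendants (n + 3)).Adj c a := ⟨hca, by omega⟩
  let p := Walk.cons h1 (.cons h2 (.cons h3 .nil))
  have hp : p.IsCycle := by
    simp [p, Walk.cons_isCycle_iff, hab, hbc, hca, hab.symm, hca.symm]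
  exact le_antisymm (girth_le_length hp) (three_le_girth fun h => h p hp)

theorem triangleWithPendants_castSucc_adj (n : ℕ) (a b : Fin n) :
    (triangleWithPendants n).Adj a b ↔
      (triangleWithPendants (n + 1)).Adj (Fin.castSuccEmb a) (Fin.castSuccEmb b) := by
  simp only [triangleWithPendants, ne_eq, Fin.castSuccEmb_apply, Fin.castSucc_inj,
    Fin.val_castSucc]

theorem triangleWithPendants_last_adj (n : ℕ) (x : Fin (n + 4)) :
    (triangleWithPendants (n + 4)).Adj (Fin.last (n + 3)) x ↔
      x = Fin.castSuccEmb (0 : Fin (n + 3)) := by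
  simp only [triangleWithPendants, ne_eq, Fin.ext_iff, Fin.val_last, Fin.castSuccEmb_apply,
    Fin.val_castSucc, Fin.val_zero]
  omega

theorem ne_last_iff_mem_range_castSuccEmb (n : ℕ) (x : Fin (n + 1)) :
    x ≠ Fin.last n ↔ x ∈ Set.range Fin.castSuccEmb := by
  exact Fin.exists_castSucc_eq.symm

/-- The last vertex is a leaf at 0, so the recurrences at the centre involve only these two
polynomials and determine them from the triangle. -/
theorem detOneAdd_triangleWithPendants (n : ℕ) :
    (triangleWithPendants (n + 3)).signlessLaplacian.detOneAdd = trianglePendantPoly n ∧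
    ((triangleWithPendants (n + 3)).signlessLaplacian.ground 0).detOneAdd =
      (1 + X) ^ (n + 1) * (1 + 3 * X) := by
  induction n with
  | zero =>
    have h : (triangleWithPendants 3) = cycleGraph 3 := by
      rw [cycleGraph_three_eq_top]
      ext a b
      simp only [triangleWithPendants, top_adj]
      omega
    have h1 := detOneAdd_cycleGraph 0 (by decide)
    have h2 := detOneAdd_ground_cycleGraph 0 0
    simp only [zero_add] at h1 h2 ⊢
    have h3 : (triangleWithPendants 3).signlessLaplacian = (cycleGraph 3).signlessLaplacian := by
      congr
    rw [h3, h1, h2]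
    constructor
    · simp only [cyclePoly, trianglePendantPoly]
      push_cast
      ring
    · simp only [pathPoly]
      ring
  | succ n ih =>
    have hP := detOneAdd_of_pendant Fin.castSuccEmb (triangleWithPendants_last_adj n)
      (ne_last_iff_mem_range_castSuccEmb _) (triangleWithPendants_castSucc_adj (n + 3))
    have hR := detOneAdd_ground_of_pendant_neighbor Fin.castSuccEmb
      (triangleWithPendants_last_adj n) (ne_last_iff_mem_range_castSuccEmb _)
      (triangleWithPendants_castSucc_adj (n + 3))
    refine ⟨hP.trans ?_, hR.trans ?_⟩
    · rw [ih.1, ih.2, trianglePendantPoly_succ]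
    · rw [ih.2]
      ring

theorem ncard_edgeSet_triangleWithPendants (n : ℕ) :
    (triangleWithPendants (n + 3)).edgeSet.ncard = n + 3 := by
  have hE : (triangleWithPendants (n + 3)).edgeSet =
      insert s(⟨1, by omega⟩, ⟨2, by omega⟩)
        (Set.range fun i : Fin (n + 2) => s((0 : Fin (n + 3)), i.succ)) := by
    ext e
    induction e with
    | _ a b =>
      simp only [mem_edgeSet, triangleWithPendants, ne_eq, Set.mem_insert_iff, Set.mem_range,
        Sym2.eq_iff]
      constructor
      · rintro ⟨hab, h⟩
        by_cases ha : a = 0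
        · obtain ⟨i, rfl⟩ := Fin.exists_succ_eq.2 (fun h => hab (ha.trans h.symm))
          exact Or.inr ⟨i, Or.inl ⟨ha.symm, rfl⟩⟩
        · by_cases hb : b = 0
          · obtain ⟨i, rfl⟩ := Fin.exists_succ_eq.2 ha
            exact Or.inr ⟨i, Or.inr ⟨hb.symm, rfl⟩⟩
          · left
            simp only [Fin.ext_iff, Fin.val_zero] at *
            omega
      · rintro (h | ⟨i, ⟨rfl, rfl⟩ | ⟨rfl, rfl⟩⟩)
        · simp only [Fin.ext_iff] at *
          omega
        · exact ⟨(Fin.succ_ne_zero i).symm, Or.inl rfl⟩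
        · exact ⟨Fin.succ_ne_zero i, Or.inr (Or.inl rfl)⟩
  rw [hE, Set.ncard_insert_of_notMem, ← Set.image_univ, Set.ncard_image_of_injective,
    Set.ncard_univ, Nat.card_fin]
  · intro i j hij
    simpa [Sym2.eq_iff] using hij
  · rintro ⟨i, hi⟩
    simp only [Sym2.eq_iff, Fin.ext_iff, Fin.val_zero] at hi
    omega

end SimpleGraph

end

open SimpleGraph in
theorem theorem5p1 (n : ℕ) (hn : 3 ≤ n) :
    ((triangleWithPendants n).IsUnicyclic ∧ Odd (triangleWithPendants n).girth) ∧
      ∀ {V : Type*} [Fintype V] [DecidableEq V] (G : SimpleGraph V) [DecidableRel G.Adj],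
        Fintype.card V = n → G.IsUnicyclic → Odd G.girth →
          ∀ i ≤ n, (triangleWithPendants n).signlessCoeff i ≤ G.signlessCoeff i := by
  obtain ⟨k, rfl⟩ := Nat.exists_eq_add_of_le' hn
  refine ⟨⟨⟨connected_triangleWithPendants k, ?_⟩, ?_⟩, ?_⟩
  · rw [ncard_edgeSet_triangleWithPendants, Nat.card_fin]
  · rw [girth_triangleWithPendants]
    decide
  · intro V _ _ G _ hV hG hodd i hi
    have he : G.edgeFinset.card = k + 3 := by
      rw [← hV, ← Nat.card_eq_fintype_card, ← hG.2, ← coe_edgeFinset, Set.ncard_coe_finset]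
    have h := (detOneAdd_lower_bounds k G hV hG.1 (not_colorable_two_of_odd_girth hodd) he).1 i
    rw [Polynomial.coeff_sub, sub_nonneg] at h
    rwa [signlessCoeff_eq_coeff_detOneAdd (by simpa using hi),
      signlessCoeff_eq_coeff_detOneAdd (by omega), (detOneAdd_triangleWithPendants k).1]
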